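/- **Setting.** Formulas are built from a set $\mathsf{atom}$ of atomic propositions with $\bot,\to,\Box$. A formula is *purely modal* if it is a boolean combination of formulas $\Box B$. A *theory* $T$ is a set of axioms together with a set of inference rules (finitely many premises, one conclusion); $T\vdash A$ means that $A$ is derivable from the axioms by the rules. $T$ is *classical* if modus ponens is one of its rules and it proves all Hilbert-style axioms of classical logic. $\mathsf{GL}$ has modus ponens as its only rule and as axioms $\Box^nA$ for classical tautologies $A$ and $\Box^n(\Box(A\to B)\to(\Box A\to\Box B))$, for all $n\ge 0$, as well as $B$ and $\Box B$ for each $B$ of the form $\Box A\to\Box\Box A$ or $\Box(\Box A\to A)\to\Box A$. A *pre-model* $\mathcal P=(W,\sqsubset,\{T_w\},V)$ is a Kripke model $(W,\sqsubset,V)$, $W\neq\emptyset$, with a theory $T_w$ for every accessible world $w$ (one having a predecessor). Truth $\mathcal P,w\models A$ commutes with $\bot$ and $\to$, is given by $V$ on atoms, and $\mathcal P,w\models\Box A$ iff $T_u\vdash A$ for all $u\sqsupset w$. Write $\sqsubset^+$ for the transitive closure of $\sqsubset$, and $\mathcal P,w\models^+A$ if there is $u\sqsubset w$ with $\mathcal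 P,v\models A$ for all $v\sqsupset^+u$. A *provability model* is a pre-model with all $T_w$ classical such that $\mathcal P,w\models^+A$ implies $T_w\vdash A$ for all purely modal $A$. It *has necessitation* if $A/\Box A$ is a rule of every $T_w$. On a fixed Kripke model, $\mathcal P\subseteq\mathcal P'$ means that every theorem of $T_w$ is a theorem of $T'_w$, for all accessible $w$. A pre-model is *bi-finite* if $W$ and the axiom sets of all $T_w$ are finite and the $T_w$ have no rules. It is *converse well-founded* if every non-empty $X\subseteq W$ contains some $w$ with $w\not\sqsubset u$ for all $u\in X$, and a *tree* if $w,u\sqsubset v$ implies $w=u$, $w\sqsubset^+u$ or $u\sqsubset^+w$. A provability model $\bar{\mathcal P}$ is *finitary* if it is generated by some bi-finite converse well-founded tree pre-model $\mathcal P$ on the same Kripke model, that is, $\bar{\mathcal P}$ is a minimum (for $\subseteq$) among the provability models with necessitation that include $\mathcal P$. It is *recursively finitary* if it has necessitation and is obtained from some bi-finite converse well-founded tree pre-model $\mathcal P$ by the recursive construction: for every accessible $w$, the theorems of $\bar T_w$ are exactly those of the theory with modus ponens as its only rule and the axioms $\Gamma\cup\{\Box A: A\in\Gamma\}$, where $\Gamma$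 consists of the axioms of $T_w$, the purely modal $A$ with $\bar{\mathcal P},w\models^+A$, and all classical tautologies. A theory $T$ is *complete* for a class of provability models if $T\vdash A$ for every formula $A$ that is true at all worlds of all models of the class. **Theorem.** 1. If $\mathsf{atom}$ is finite, then $\mathsf{GL}$ is complete for the class of finitary provability models. 2. For an arbitrary set $\mathsf{atom}$, $\mathsf{GL}$ is complete for the class of recursively finitary provability models. -/

import Mathlib

universe u v

namespace ProvabilityModels

/-! ### The modal language -/

/-- Formulas of the unimodal language over a set `Atom` of atomic propositions. -/
inductive Formula (Atom : Type u) : Type u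
  | atom : Atom → Formula Atom
  | bot : Formula Atom
  | imp : Formula Atom → Formula Atom → Formula Atom
  | box : Formula Atom → Formula Atom

namespace Formula

variable {Atom : Type u}

/-- Negation, `¬A := A → ⊥`. -/
def neg (A : Formula Atom) : Formula Atom := A.imp bot

/-- `boxIter n A` is `□ⁿ A`. -/
def boxIter : ℕ → Formula Atom → Formula Atom
  | 0, A => A
  | n + 1, A => box (boxIter n A)

/-- A formula is purely modal if it is a boolean combination of boxed formulas, i.e. every atomic
proposition in it is in the scope of a box. -/
def PurelyModal : Formula Atom → Prop
  | atom _ => False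
  | bot => True
  | imp A B => PurelyModal A ∧ PurelyModal B
  | box _ => True

/-- The truth value of a formula as a propositional formula, where atoms and boxed formulas
are evaluated by arbitrary assignments `f` and `g`. -/
def boolEval (f : Atom → Prop) (g : Formula Atom → Prop) : Formula Atom → Prop
  | atom p => f p
  | bot => False
  | imp A B => boolEval f g A → boolEval f g B
  | box A => g A

/-- Classical tautologies of the modal language. -/
def Tautology (A : Formula Atom) : Prop := ∀ f g, boolEval f g A

end Formula

open Formula

/-! ### Theories -/

/-- A (single instance of a) single-conclusion inference rule with finitely many premises. -/
structure Rule (Atom : Type u) where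
  premises : Set (Formula Atom)
  finite : premises.Finite
  conclusion : Formula Atom

/-- All instances of modus ponens. -/
def modusPonens (Atom : Type u) : Set (Rule Atom) :=
  {r | ∃ A B : Formula Atom, r.premises = {A, A.imp B} ∧ r.conclusion = B}

/-- All instances of necessitation. -/
def necessitation (Atom : Type u) : Set (Rule Atom) :=
  {r | ∃ A : Formula Atom, r.premises = {A} ∧ r.conclusion = box A}

/-- A theory is a pair of a set of axioms and a set of inference rules. -/
structure Theory (Atom : Type u) where
  axioms : Set (Formula Atom)
  rules : Set (Rule Atom)

namespace Theory

variable {Atom : Type u}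

/-- `T.Derives Γ A`: there is a derivation of `A` in `T` from the assumptions `Γ`. -/
inductive Derives (T : Theory Atom) (Γ : Set (Formula Atom)) : Formula Atom → Prop
  | ax {A : Formula Atom} : A ∈ T.axioms → Derives T Γ A
  | hyp {A : Formula Atom} : A ∈ Γ → Derives T Γ A
  | rule (r : Rule Atom) : r ∈ T.rules → (∀ A ∈ r.premises, Derives T Γ A) →
      Derives T Γ r.conclusion

/-- `A` is a theorem of `T`. -/
def Provable (T : Theory Atom) (A : Formula Atom) : Prop := T.Derives ∅ A

/-- `T'` includes `T` if all theorems of `T` are theorems of `T'`. -/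
def IncludedIn (T T' : Theory Atom) : Prop := ∀ A, T.Provable A → T'.Provable A

end Theory

/-- Hilbert-style axioms of classical logic in the connectives `→` and `⊥`. -/
inductive HilbertAxiom {Atom : Type u} : Formula Atom → Prop
  | k (A B : Formula Atom) : HilbertAxiom (A.imp (B.imp A))
  | s (A B C : Formula Atom) :
      HilbertAxiom ((A.imp (B.imp C)).imp ((A.imp B).imp (A.imp C)))
  | dne (A : Formula Atom) : HilbertAxiom (A.neg.neg.imp A)

/-- A theory is classical if modus ponens is among its rules and all Hilbert-style axioms of
classical logic are theorems of it. -/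
def Theory.Classical {Atom : Type u} (T : Theory Atom) : Prop :=
  modusPonens Atom ⊆ T.rules ∧ ∀ A, HilbertAxiom A → T.Provable A

/-- Axioms of the logic `GL`, in the axiomatization without necessitation. -/
inductive GLAxiom {Atom : Type u} : Formula Atom → Prop
  | taut (n : ℕ) (A : Formula Atom) : Tautology A → GLAxiom (boxIter n A)
  | distrib (n : ℕ) (A B : Formula Atom) :
      GLAxiom (boxIter n ((box (A.imp B)).imp ((box A).imp (box B))))
  | four (A : Formula Atom) : GLAxiom ((box A).imp (box (box A)))
  | boxFour (A : Formula Atom) : GLAxiom (box ((box A).imp (box (box A))))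
  | loeb (A : Formula Atom) : GLAxiom ((box ((box A).imp A)).imp (box A))
  | boxLoeb (A : Formula Atom) : GLAxiom (box ((box ((box A).imp A)).imp (box A)))

/-- The Gödel–Löb provability logic `GL`, with modus ponens as its only rule. -/
def logicGL (Atom : Type u) : Theory Atom where
  axioms := {A | GLAxiom A}
  rules := modusPonens Atom

/-! ### Kripke models and provability models -/

/-- A Kripke model: a non-empty set of worlds, a binary relation and a valuation. -/
structure KripkeModel (Atom : Type u) where
  World : Type v
  nonempty : Nonempty World
  rel : World → World → Prop
  val : World → Atom → Prop

namespace KripkeModel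

variable {Atom : Type u} (K : KripkeModel.{u, v} Atom)

/-- The accessible worlds. -/
def Accessible : Type v := {w : K.World // ∃ u, K.rel u w}

/-- Converse well-foundedness: every non-empty set of worlds has a maximal element. -/
def ConverseWellFounded : Prop :=
  ∀ X : Set K.World, X.Nonempty → ∃ w ∈ X, ∀ u ∈ X, ¬ K.rel w u

/-- Trees (not necessarily rooted): any two predecessors of a world are equal or comparable in
the transitive closure of the accessibility relation. -/
def IsTree : Prop :=
  ∀ w u v : K.World, K.rel w v → K.rel u v →
    w = u ∨ Relation.TransGen K.rel w u ∨ Relation.TransGen K.rel u w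

end KripkeModel

/-- A provability pre-model on the Kripke model `K`: a theory for each accessible world. -/
structure PreModel {Atom : Type u} (K : KripkeModel.{u, v} Atom) where
  thy : K.Accessible → Theory Atom

namespace PreModel

variable {Atom : Type u} {K : KripkeModel.{u, v} Atom}

/-- Truth at a world: `□A` is true at `w` iff `A` is a theorem of the theory of every world
accessible from `w`. -/
def Forces (P : PreModel K) (w : K.World) : Formula Atom → Prop
  | atom p => K.val w p
  | bot => False
  | imp A B => P.Forces w A → P.Forces w B
  | box A => ∀ (u : K.World) (h : K.rel w u), (P.thy ⟨u, w, h⟩).Provable A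

/-- `w ⊨⁺ A`: for some predecessor `u` of `w`, `A` is true at all `v` strictly above `u` in the
transitive closure. -/
def ForcesPlus (P : PreModel K) (w : K.World) (A : Formula Atom) : Prop :=
  ∃ u, K.rel u w ∧ ∀ v, Relation.TransGen K.rel u v → P.Forces v A

/-- Truth at all worlds. -/
def Valid (P : PreModel K) (A : Formula Atom) : Prop := ∀ w, P.Forces w A

/-- Modal completeness. -/
def ModallyComplete (P : PreModel K) : Prop :=
  ∀ (w : K.Accessible) (A : Formula Atom), A.PurelyModal → P.ForcesPlus w.1 A →
    (P.thy w).Provable A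

/-- A provability model is a modally complete pre-model, all of whose theories are classical. -/
def IsProvabilityModel (P : PreModel K) : Prop :=
  (∀ w, (P.thy w).Classical) ∧ P.ModallyComplete

/-- Necessitation is among the rules of all theories of the pre-model. -/
def HasNecessitation (P : PreModel K) : Prop := ∀ w, necessitation Atom ⊆ (P.thy w).rules

/-- `P` is a submodel of `P'`: same frame and valuation, and each theory of `P'` includes the
corresponding theory of `P`. -/
def Submodel (P P' : PreModel K) : Prop := ∀ w, (P.thy w).IncludedIn (P'.thy w)

/-- Bi-finite pre-models: finitely many worlds, finitely many axioms at each of them, and no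
inference rules. -/
def BiFinite (P : PreModel K) : Prop :=
  Finite K.World ∧ ∀ w, (P.thy w).axioms.Finite ∧ (P.thy w).rules = ∅

/-- `Q` is a minimum provability model with necessitation among those that extend `P`
(as submodels). -/
def IsGeneratedBy (Q P : PreModel K) : Prop :=
  (Q.IsProvabilityModel ∧ Q.HasNecessitation ∧ P.Submodel Q) ∧
    ∀ P' : PreModel K, P'.IsProvabilityModel → P'.HasNecessitation → P.Submodel P' → Q.Submodel P'

/-- Finitary provability models: those generated by a bi-finite converse well-founded tree
pre-model. -/
def Finitary (Q : PreModel K) : Prop :=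
  ∃ P : PreModel K, P.BiFinite ∧ K.ConverseWellFounded ∧ K.IsTree ∧ Q.IsGeneratedBy P

/-- The axioms of `P` at `w`, the purely modal formulas `A` with `w ⊨⁺ A` in `Q`, and the classical
tautologies. -/
def stageSet (P Q : PreModel K) (w : K.Accessible) : Set (Formula Atom) :=
  (P.thy w).axioms ∪ {A | A.PurelyModal ∧ Q.ForcesPlus w.1 A} ∪ {A | A.Tautology}

/-- The theory with axioms `Γ ∪ □Γ`, for `Γ = stageSet P Q w`, and modus ponens as its rule. -/
def stageTheory (P Q : PreModel K) (w : K.Accessible) : Theory Atom where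
  axioms := stageSet P Q w ∪ box '' stageSet P Q w
  rules := modusPonens Atom

/-- `Q` is a provability model with necessitation whose theories have the theorems prescribed by
the recursive construction over `P`. On converse well-founded trees the purely modal formulas in
`stageSet P Q w` depend only on theories of `Q` at worlds that are treated earlier in the recursion,
so the equation determines the theorems of `Q` uniquely. -/
def IsConstructedFrom (Q P : PreModel K) : Prop :=
  Q.IsProvabilityModel ∧ Q.HasNecessitation ∧
    ∀ w A, (Q.thy w).Provable A ↔ (stageTheory P Q w).Provable A

/-- Provability models obtained by the recursive construction from a bi-finite converse
well-founded tree pre-model. -/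
def RecursivelyFinitary (Q : PreModel K) : Prop :=
  ∃ P : PreModel K, P.BiFinite ∧ K.ConverseWellFounded ∧ K.IsTree ∧ Q.IsConstructedFrom P

end PreModel

/-- A theory is complete for a class of pre-models if it proves every formula that is valid in all
members of the class. -/
def Theory.CompleteFor {Atom : Type u} (T : Theory Atom)
    (C : (K : KripkeModel.{u, v} Atom) → Set (PreModel K)) : Prop :=
  ∀ A : Formula Atom, (∀ (K : KripkeModel.{u, v} Atom), ∀ P ∈ C K, P.Valid A) → T.Provable A

end ProvabilityModels

/-! A formula `A` that `GL` does not prove fails in a finite strict transitive tree. Fix a finite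
set `F` of atoms containing those of `A`, and let the theory at `w` consist of the formulas true at
`w` and at every world above it, whatever values the atoms outside `F` take (`upModel`). Passing to
all worlds above makes these theories closed under necessitation; by transitivity it does not change
the truth of boxed formulas, so truth in `upModel` is the Kripke semantics `Sat` and `A` still fails
(`forces_upModel`).

It remains to obtain this model from finitely many axioms. Since the frame is finite and converse
well-founded, each world has a characteristic formula `χ w`, and the single axiom at `w` is the
disjunction of `χ v` over `v = w` and `v` above `w`. If `F` contains all atoms, `χ v` decides every
formula already in the minimal normal logic (`characteristic_decides`), so every provability model
with necessitation that has these axioms includes `upModel`: this gives the finitary case. For a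
general finite `F` the atoms outside `F` stay undecided. There the recursive construction supplies
all purely modal formulas valid in the model, and these make the boxed part of any maximal extension
agree with some world `v` (`sat_box_iff_of_sat_modalPart`). -/

namespace ProvabilityModels

open Formula

/-! ### Boolean sets of formulas -/

section Boolean

variable {Atom : Type u}

/-- A set of formulas that contains the Hilbert-style axioms and is closed under modus ponens. -/
structure DeductivelyClosed (S : Set (Formula Atom)) : Prop where
  hilbert : ∀ A, HilbertAxiom A → A ∈ S
  mp : ∀ A B, A ∈ S → A.imp B ∈ S → B ∈ S

/-- A set of formulas that commutes with the boolean connectives. -/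
structure IsBoolean (X : Set (Formula Atom)) : Prop where
  bot : Formula.bot ∉ X
  imp : ∀ A B, A.imp B ∈ X ↔ (A ∈ X → B ∈ X)

namespace DeductivelyClosed

variable {S : Set (Formula Atom)}

theorem imp_of_mem (hS : DeductivelyClosed S) {A : Formula Atom} (B : Formula Atom) (hA : A ∈ S) :
    B.imp A ∈ S :=
  hS.mp _ _ hA (hS.hilbert _ (.k A B))

theorem imp_self (hS : DeductivelyClosed S) (A : Formula Atom) : A.imp A ∈ S :=
  hS.mp _ _ (hS.hilbert _ (.k A A)) (hS.mp _ _ (hS.hilbert _ (.k A (A.imp A)))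
    (hS.hilbert _ (.s A (A.imp A) A)))

theorem dne (hS : DeductivelyClosed S) {A : Formula Atom} (h : A.neg.neg ∈ S) : A ∈ S :=
  hS.mp _ _ h (hS.hilbert _ (.dne A))

theorem exfalso (hS : DeductivelyClosed S) {A : Formula Atom} (h : Formula.bot ∈ S) : A ∈ S :=
  hS.dne (hS.imp_of_mem _ h)

/-- The deduction theorem. -/
theorem adjoin (hS : DeductivelyClosed S) (A : Formula Atom) :
    DeductivelyClosed {B | A.imp B ∈ S} where
  hilbert B hB := hS.imp_of_mem A (hS.hilbert B hB)
  mp B C hB hBC := hS.mp _ _ hB (hS.mp _ _ hBC (hS.hilbert _ (.s A B C)))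

/-- Lindenbaum's lemma. -/
theorem exists_isBoolean (hS : DeductivelyClosed S) {B : Formula Atom} (hB : B ∉ S) :
    ∃ X, IsBoolean X ∧ S ⊆ X ∧ B ∉ X := by
  have bound : ∀ c ⊆ {X : Set (Formula Atom) | DeductivelyClosed X ∧ B ∉ X},
      IsChain (· ⊆ ·) c → c.Nonempty →
        ∃ ub ∈ {X : Set (Formula Atom) | DeductivelyClosed X ∧ B ∉ X}, ∀ s ∈ c, s ⊆ ub := by
    intro c hc hchain hne
    refine ⟨⋃₀ c, ⟨⟨fun A hA => ?_, fun A C hA hAC => ?_⟩, ?_⟩,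
      fun s hs => Set.subset_sUnion_of_mem hs⟩
    · obtain ⟨s, hs⟩ := hne
      exact ⟨s, hs, (hc hs).1.hilbert A hA⟩
    · obtain ⟨s, hs, hAs⟩ := hA
      obtain ⟨t, ht, hACt⟩ := hAC
      rcases hchain.total hs ht with h | h
      · exact ⟨t, ht, (hc ht).1.mp _ _ (h hAs) hACt⟩
      · exact ⟨s, hs, (hc hs).1.mp _ _ hAs (h hACt)⟩
    · rintro ⟨s, hs, hBs⟩
      exact (hc hs).2 hBs
  obtain ⟨X, hSX, hX⟩ := zorn_subset_nonempty _ bound S ⟨hS, hB⟩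
  obtain ⟨⟨hXd, hXB⟩, hmax⟩ := hX
  -- By maximality, adjoining a formula outside `X` must make `B` derivable.
  have key : ∀ A, A ∉ X → A.imp B ∈ X := by
    intro A hA
    by_contra h
    exact hA (hmax (y := {C | A.imp C ∈ X}) ⟨hXd.adjoin A, h⟩
      (fun C hC => hXd.imp_of_mem A hC) (hXd.imp_self A))
  refine ⟨X, ⟨fun h => hXB (hXd.exfalso h), fun A C => ⟨fun h hA => hXd.mp _ _ hA h, ?_⟩⟩,
    hSX, hXB⟩
  intro h
  by_contra hAC
  by_cases hA : A ∈ X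
  · exact hAC (hXd.imp_of_mem A (h hA))
  have h1 := key _ hA
  have h2 := key _ hAC
  -- Peirce-style argument: under `¬B`, `A` yields `B` and so a contradiction, which proves `A → C`;
  -- then `h2` yields `B`. Hence `¬¬B`, and so `B`, lies in `X`.
  have d1 := hXd.adjoin B.neg
  have d2 := d1.adjoin A
  have h3 : A.imp C ∈ {D | B.neg.imp D ∈ X} := by
    refine d2.exfalso (d2.mp B _ ?_ ?_)
    · exact hXd.imp_of_mem _ h1
    · exact d1.imp_of_mem A (hXd.imp_self B.neg)
  exact hXB (hXd.dne (d1.mp _ _ (d1.mp _ _ h3 (hXd.imp_of_mem _ h2)) (hXd.imp_self B.neg)))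

theorem mem_of_forall_isBoolean (hS : DeductivelyClosed S) {B : Formula Atom}
    (h : ∀ X, IsBoolean X → S ⊆ X → B ∈ X) : B ∈ S := by
  by_contra hB
  obtain ⟨X, hX, hSX, hBX⟩ := hS.exists_isBoolean hB
  exact hBX (h X hX hSX)

end DeductivelyClosed

theorem HilbertAxiom.tautology {A : Formula Atom} (h : HilbertAxiom A) : A.Tautology := by
  intro f g
  cases h <;> simp only [boolEval, neg] <;> tauto

namespace IsBoolean

variable {X : Set (Formula Atom)}

theorem boolEval_iff (hX : IsBoolean X) (A : Formula Atom) :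
    boolEval (fun p => Formula.atom p ∈ X) (fun B => box B ∈ X) A ↔ A ∈ X := by
  induction A with
  | atom p => rfl
  | bot => simp [boolEval, hX.bot]
  | imp A B ihA ihB => simp only [boolEval, hX.imp, ihA, ihB]
  | box A => rfl

theorem mem_of_tautology (hX : IsBoolean X) {A : Formula Atom} (hA : A.Tautology) : A ∈ X :=
  (hX.boolEval_iff A).1 (hA _ _)

theorem neg_mem_iff (hX : IsBoolean X) (A : Formula Atom) : A.neg ∈ X ↔ A ∉ X := by
  simp [neg, hX.imp, hX.bot]

end IsBoolean

/-- The conjunction of a list of formulas. -/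
def conj : List (Formula Atom) → Formula Atom
  | [] => neg bot
  | A :: L => neg (A.imp (conj L).neg)

/-- The disjunction of a list of formulas. -/
def disj : List (Formula Atom) → Formula Atom
  | [] => bot
  | A :: L => A.neg.imp (disj L)

theorem IsBoolean.conj_mem_iff {X : Set (Formula Atom)} (hX : IsBoolean X)
    (L : List (Formula Atom)) : conj L ∈ X ↔ ∀ A ∈ L, A ∈ X := by
  induction L with
  | nil => simp [conj, hX.neg_mem_iff, hX.bot]
  | cons A L ih => simp [conj, hX.neg_mem_iff, hX.imp, ih]

theorem IsBoolean.disj_mem_iff {X : Set (Formula Atom)} (hX : IsBoolean X)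
    (L : List (Formula Atom)) : disj L ∈ X ↔ ∃ A ∈ L, A ∈ X := by
  induction L with
  | nil => simp [disj, hX.bot]
  | cons A L ih => 
    simp only [disj, hX.neg_mem_iff, hX.imp, ih, List.exists_mem_cons_iff]
    exact or_iff_not_imp_left.symm

theorem purelyModal_conj {L : List (Formula Atom)} (h : ∀ A ∈ L, A.PurelyModal) :
    (conj L).PurelyModal := by
  induction L with
  | nil => simp [conj, neg, PurelyModal]
  | cons A L ih =>
    have := ih fun B hB => h B (List.mem_cons_of_mem _ hB)
    have := h A List.mem_cons_self
    simp_all [conj, neg, PurelyModal]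

theorem Theory.Provable.mp {T : Theory Atom} (hT : modusPonens Atom ⊆ T.rules) {A B : Formula Atom}
    (hA : T.Provable A) (hAB : T.Provable (A.imp B)) : T.Provable B := by
  refine Theory.Derives.rule (T := T)
    (⟨{A, A.imp B}, Set.toFinite _, B⟩ : Rule Atom) (hT ⟨A, B, rfl, rfl⟩) ?_
  rintro C (rfl | rfl)
  exacts [hA, hAB]

theorem Theory.Provable.nec {T : Theory Atom} (hT : necessitation Atom ⊆ T.rules) {A : Formula Atom}
    (hA : T.Provable A) : T.Provable (box A) := by
  refine Theory.Derives.rule (T := T)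
    (⟨{A}, Set.toFinite _, box A⟩ : Rule Atom) (hT ⟨A, rfl, rfl⟩) ?_
  rintro C rfl
  exact hA

theorem Theory.Classical.deductivelyClosed {T : Theory Atom} (hT : T.Classical) :
    DeductivelyClosed {A | T.Provable A} :=
  ⟨hT.2, fun _ _ hA hAB => hA.mp hT.1 hAB⟩

/-- Induction over theorems of a theory with modus ponens as its only rule. -/
theorem Theory.Provable.mem_of_axioms {T : Theory Atom} (hT : T.rules = modusPonens Atom)
    {S : Set (Formula Atom)} (hax : T.axioms ⊆ S)
    (hmp : ∀ A B, A ∈ S → A.imp B ∈ S → B ∈ S) {A : Formula Atom} (h : T.Provable A) : A ∈ S := by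
  unfold Theory.Provable at h
  induction h with
  | ax h => exact hax h
  | hyp h => exact h.elim
  | rule r hr _ ih =>
    rw [hT] at hr
    obtain ⟨A, B, hp, hc⟩ := hr
    rw [hp] at ih
    rw [hc]
    exact hmp A B (ih _ (by simp)) (ih _ (by simp))

end Boolean

/-! ### The logic `GL` -/

section Logic

variable {Atom : Type u}

/-- The theorems of `GL`. -/
def theoremsGL (Atom : Type u) : Set (Formula Atom) := {A | (logicGL Atom).Provable A}

theorem mem_theoremsGL_of_axiom {A : Formula Atom} (h : GLAxiom A) : A ∈ theoremsGL Atom :=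
  Theory.Derives.ax h

theorem theoremsGL_mp {A B : Formula Atom} (hA : A ∈ theoremsGL Atom)
    (hAB : A.imp B ∈ theoremsGL Atom) : B ∈ theoremsGL Atom :=
  Theory.Provable.mp (T := logicGL Atom) subset_rfl hA hAB

theorem theoremsGL_of_tautology {A : Formula Atom} (h : A.Tautology) : A ∈ theoremsGL Atom :=
  mem_theoremsGL_of_axiom (.taut 0 A h)

theorem theoremsGL_distrib (A B : Formula Atom) :
    (box (A.imp B)).imp ((box A).imp (box B)) ∈ theoremsGL Atom :=
  mem_theoremsGL_of_axiom (.distrib 0 A B)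

theorem deductivelyClosed_theoremsGL : DeductivelyClosed (theoremsGL Atom) :=
  ⟨fun _ h => theoremsGL_of_tautology h.tautology, fun _ _ => theoremsGL_mp⟩

/-- Necessitation is admissible: the tautology and distribution axioms come with any number of
boxes, and for the others, which come with at most one, a further box is added by transitivity. -/
theorem theoremsGL_nec {A : Formula Atom} (h : A ∈ theoremsGL Atom) :
    box A ∈ theoremsGL Atom := by
  refine Theory.Provable.mem_of_axioms (T := logicGL Atom) rfl
    (S := {A | box A ∈ theoremsGL Atom}) ?_ ?_ h
  · intro A hA
    cases (hA : GLAxiom A) with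
    | taut n A h => exact mem_theoremsGL_of_axiom (.taut (n + 1) A h)
    | distrib n A B => exact mem_theoremsGL_of_axiom (.distrib (n + 1) A B)
    | four A => exact mem_theoremsGL_of_axiom (.boxFour A)
    | boxFour A =>
      exact theoremsGL_mp (mem_theoremsGL_of_axiom (.boxFour A))
        (mem_theoremsGL_of_axiom (.four _))
    | loeb A => exact mem_theoremsGL_of_axiom (.boxLoeb A)
    | boxLoeb A =>
      exact theoremsGL_mp (mem_theoremsGL_of_axiom (.boxLoeb A))
        (mem_theoremsGL_of_axiom (.four _))
  · intro A B hA hAB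
    exact theoremsGL_mp hA (theoremsGL_mp hAB (theoremsGL_distrib A B))

/-! ### Canonical successors and the finite tree of paths -/

/-- Every refuted `□B` has a witness in which `B` fails and `□B` holds. -/
theorem exists_successor {X : Set (Formula Atom)} (hX : IsBoolean X) (hGL : theoremsGL Atom ⊆ X)
    {B : Formula Atom} (hB : box B ∉ X) :
    ∃ Y, IsBoolean Y ∧ theoremsGL Atom ⊆ Y ∧ (∀ C, box C ∈ X → C ∈ Y ∧ box C ∈ Y) ∧
      box B ∈ Y ∧ B ∉ Y := by
  have mono : ∀ C D : Formula Atom, C.imp D ∈ theoremsGL Atom → box C ∈ X → box D ∈ X := by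
    intro C D h hC
    exact (hX.imp _ _).1 (hGL (theoremsGL_mp (theoremsGL_nec h) (theoremsGL_distrib C D))) hC
  have of_box : ∀ C, box C ∈ X → box ((box B).imp C) ∈ X := by
    intro C
    refine mono _ _ (deductivelyClosed_theoremsGL.hilbert _ (.k C (box B)))
  have of_GL : ∀ C, C ∈ theoremsGL Atom → box ((box B).imp C) ∈ X :=
    fun C hC => of_box C (hGL (theoremsGL_nec hC))
  have hS : DeductivelyClosed {C | box ((box B).imp C) ∈ X} := by
    refine ⟨fun C hC => of_GL C (deductivelyClosed_theoremsGL.hilbert C hC), fun C D hC hCD => ?_⟩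
    have := mono _ _ (deductivelyClosed_theoremsGL.hilbert _ (.s (box B) C D)) hCD
    exact (hX.imp _ _).1 ((hX.imp _ _).1 (hGL (theoremsGL_distrib _ _)) this) hC
  -- `B` is not in the closed set of `hS`, since Löb's axiom would turn `□(□B → B)` into `□B`.
  obtain ⟨Y, hY, hSY, hBY⟩ := hS.exists_isBoolean (B := B) fun h =>
    hB ((hX.imp _ _).1 (hGL (mem_theoremsGL_of_axiom (.loeb B))) h)
  refine ⟨Y, hY, fun C hC => hSY (of_GL C hC), fun C hC => ⟨hSY (of_box C hC), hSY (of_box _ ?_)⟩,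
    hSY (hGL (theoremsGL_nec (deductivelyClosed_theoremsGL.imp_self _))), hBY⟩
  exact (hX.imp _ _).1 (hGL (mem_theoremsGL_of_axiom (.four C))) hC

/-- Boolean sets of formulas that contain all theorems of `GL`. -/
def MaximalGL (Atom : Type u) : Type u :=
  {X : Set (Formula Atom) // IsBoolean X ∧ theoremsGL Atom ⊆ X}

theorem exists_successor_function (X : MaximalGL Atom) (B : Formula Atom) :
    ∃ Y : MaximalGL Atom, box B ∉ X.1 →
      (∀ C, box C ∈ X.1 → C ∈ Y.1 ∧ box C ∈ Y.1) ∧ box B ∈ Y.1 ∧ B ∉ Y.1 := by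
  by_cases h : box B ∈ X.1
  · exact ⟨X, fun h' => absurd h h'⟩
  · obtain ⟨Y, h1, h2, h3⟩ := exists_successor X.2.1 X.2.2 h
    exact ⟨⟨Y, h1, h2⟩, fun _ => h3⟩

/-- A witness for the refutation of `□B` in `X`. -/
noncomputable def successor (X : MaximalGL Atom) (B : Formula Atom) : MaximalGL Atom :=
  (exists_successor_function X B).choose

theorem successor_spec (X : MaximalGL Atom) {B : Formula Atom} (h : box B ∉ X.1) :
    (∀ C, box C ∈ X.1 → C ∈ (successor X B).1 ∧ box C ∈ (successor X B).1) ∧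
      box B ∈ (successor X B).1 ∧ B ∉ (successor X B).1 :=
  (exists_successor_function X B).choose_spec h

/-- The set of formulas reached from `X` along a list of refuted boxes (the last one first). -/
noncomputable def pathSet (X : MaximalGL Atom) : List (Formula Atom) → MaximalGL Atom
  | [] => X
  | B :: l => successor (pathSet X l) B

/-- The lists along which each step refutes a box from `Φ`. -/
def IsPath (Φ : Set (Formula Atom)) (X : MaximalGL Atom) : List (Formula Atom) → Prop
  | [] => True
  | B :: l => IsPath Φ X l ∧ box B ∈ Φ ∧ box B ∉ (pathSet X l).1

variable {Φ : Set (Formula Atom)} {X : MaximalGL Atom}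

theorem IsPath.box_mem {l : List (Formula Atom)} (h : IsPath Φ X l) :
    ∀ B ∈ l, box B ∈ Φ ∧ box B ∈ (pathSet X l).1 := by
  induction l with
  | nil => simp
  | cons C l ih =>
    obtain ⟨hl, hC, hCl⟩ := h
    have hs := successor_spec _ hCl
    intro B hB
    rcases List.mem_cons.1 hB with rfl | hB
    · exact ⟨hC, hs.2.1⟩
    · exact ⟨(ih hl B hB).1, (hs.1 B (ih hl B hB).2).2⟩

/-- Once `□B` has been refuted it holds at all later points, so `B` cannot be used again. This
bounds the length of paths by the number of boxes in `Φ`. -/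
theorem IsPath.nodup {l : List (Formula Atom)} (h : IsPath Φ X l) : l.Nodup := by
  induction l with
  | nil => simp
  | cons C l ih => exact List.nodup_cons.2 ⟨fun hC => h.2.2 (h.1.box_mem C hC).2, ih h.1⟩

theorem finite_isPath (hΦ : Φ.Finite) : {l | IsPath Φ X l}.Finite := by
  have hΨ : {B | box B ∈ Φ}.Finite := hΦ.preimage (fun A _ B _ h => Formula.box.inj h)
  have := hΨ.to_subtype
  have := Fintype.ofFinite {B | box B ∈ Φ}
  refine ((List.finite_length_le {B | box B ∈ Φ} (Fintype.card {B | box B ∈ Φ})).image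
    (List.map Subtype.val)).subset ?_
  intro l hl
  have hl' : ∀ B ∈ l, B ∈ {B | box B ∈ Φ} := fun B hB => (hl.box_mem B hB).1
  refine ⟨l.attach.map (fun B => ⟨B.1, hl' B.1 B.2⟩), ?_, by simp [Function.comp_def]⟩
  refine List.Nodup.length_le_card (List.Nodup.map ?_ (List.nodup_attach.2 hl.nodup))
  intro a b hab
  simpa [Subtype.ext_iff] using hab

theorem pathSet_of_suffix {l l' : List (Formula Atom)} (hl' : IsPath Φ X l') (h : l <:+ l')
    (hne : l ≠ l') {C : Formula Atom} (hC : box C ∈ (pathSet X l).1) :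
    C ∈ (pathSet X l').1 ∧ box C ∈ (pathSet X l').1 := by
  induction l' with
  | nil => exact absurd (List.suffix_nil.1 h) hne
  | cons B l' ih =>
    have hs := (successor_spec _ hl'.2.2).1
    rcases List.suffix_cons_iff.1 h with rfl | h
    · exact absurd rfl hne
    · by_cases hl : l = l'
      · subst hl
        exact hs C hC
      · exact hs C (ih hl'.1 h hl).2

/-- Every formula lies in a finite set that is closed under
immediate subformulas. -/
theorem exists_finite_subformulaClosed (A : Formula Atom) :
    ∃ Φ : Set (Formula Atom), Φ.Finite ∧ A ∈ Φ ∧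
      (∀ B C, B.imp C ∈ Φ → B ∈ Φ ∧ C ∈ Φ) ∧ ∀ B, box B ∈ Φ → B ∈ Φ := by
  induction A with
  | atom p => exact ⟨{.atom p}, by simp⟩
  | bot => exact ⟨{.bot}, by simp⟩
  | imp A B ihA ihB =>
    obtain ⟨Φ, h1, h2, h3, h4⟩ := ihA
    obtain ⟨Ψ, k1, k2, k3, k4⟩ := ihB
    refine ⟨insert (A.imp B) (Φ ∪ Ψ), (h1.union k1).insert _, by simp, ?_, ?_⟩
    · rintro C D (h | h | h)
      · cases h
        simp [h2, k2]
      · simp [h3 _ _ h]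
      · simp [k3 _ _ h]
    · rintro C (h | h | h)
      · cases h
      · simp [h4 _ h]
      · simp [k4 _ h]
  | box A ih =>
    obtain ⟨Φ, h1, h2, h3, h4⟩ := ih
    refine ⟨insert (box A) Φ, h1.insert _, by simp, ?_, ?_⟩
    · rintro C D (h | h)
      · cases h
      · simp [h3 _ _ h]
    · rintro C (h | h)
      · cases h
        simp [h2]
      · simp [h4 _ h]

end Logic

/-! ### Kripke semantics with free atoms -/

section Semantics

variable {Atom : Type u} {W : Type v}

/-- Kripke semantics on a frame, where only the atoms in `F` have a fixed value at each world, and a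
box quantifies over all values of the other atoms. -/
def Sat (r : W → W → Prop) (V : W → Atom → Prop) (F : Set Atom) :
    W → (Atom → Prop) → Formula Atom → Prop
  | _, f, .atom p => f p
  | _, _, .bot => False
  | w, f, .imp A B => Sat r V F w f A → Sat r V F w f B
  | w, _, .box A => ∀ u, r w u → ∀ g : Atom → Prop, (∀ p ∈ F, g p ↔ V u p) → Sat r V F u g A

variable {r : W → W → Prop} {V : W → Atom → Prop} {F : Set Atom}

theorem isBoolean_sat (w : W) (f : Atom → Prop) : IsBoolean {A | Sat r V F w f A} :=
  ⟨id, fun _ _ => Iff.rfl⟩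

theorem sat_of_purelyModal {A : Formula Atom} (hA : A.PurelyModal) (w : W) (f g : Atom → Prop) :
    Sat r V F w f A ↔ Sat r V F w g A := by
  induction A with
  | atom p => exact hA.elim
  | bot => rfl
  | imp A B ihA ihB => simp only [Sat, ihA hA.1, ihB hA.2]
  | box A => rfl

/-- `GL` is complete for finite transitive irreflexive trees. -/
theorem exists_countermodel {A : Formula Atom} (hA : A ∉ theoremsGL Atom) :
    ∃ (W : Type v) (r : W → W → Prop) (V : W → Atom → Prop) (_ : Finite W) (_ : Nonempty W),
      (∀ a b c, r a b → r b c → r a c) ∧ (∀ a, ¬ r a a) ∧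
      (∀ a b c, r a c → r b c → a = b ∨ r a b ∨ r b a) ∧
      ∃ F₀ : Finset Atom, ∀ F : Finset Atom, F₀ ⊆ F → ∃ w, ¬ Sat r V F w (V w) A := by
  obtain ⟨X₀, hX₀, hGL, hAX⟩ := deductivelyClosed_theoremsGL.exists_isBoolean hA
  obtain ⟨Φ, hΦ, hAΦ, himp, hbox⟩ := exists_finite_subformulaClosed A
  let X : MaximalGL Atom := ⟨X₀, hX₀, hGL⟩
  have : Finite {l // IsPath Φ X l} := (finite_isPath (X := X) hΦ).to_subtype
  -- The worlds are the paths ordered by proper suffix; a finite type of paths has a copy in the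
  -- universe required of worlds.
  let e := equivShrink.{v} {l // IsPath Φ X l}
  let path : Shrink.{v} {l // IsPath Φ X l} → List (Formula Atom) := fun w => (e.symm w).1
  have hpath : ∀ w, IsPath Φ X (path w) := fun w => (e.symm w).2
  have inj : ∀ w u, path w = path u → w = u := fun w u h => e.symm.injective (Subtype.ext h)
  have surj : ∀ l, IsPath Φ X l → ∃ w, path w = l := fun l hl => ⟨e ⟨l, hl⟩, by simp [path]⟩
  have hfin : {p | Formula.atom p ∈ Φ}.Finite :=
    hΦ.preimage (fun p _ q _ h => Formula.atom.inj h)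
  refine ⟨Shrink.{v} {l // IsPath Φ X l}, fun w u => path w <:+ path u ∧ path w ≠ path u,
    fun w p => .atom p ∈ (pathSet X (path w)).1, Finite.of_equiv _ e, ⟨e ⟨[], trivial⟩⟩,
    ?_, ?_, ?_, hfin.toFinset, ?_⟩
  · rintro a b c ⟨hab, hab'⟩ ⟨hbc, hbc'⟩
    refine ⟨hab.trans hbc, fun h => hab' ?_⟩
    rw [← h] at hbc
    exact hab.eq_of_length (le_antisymm hab.length_le hbc.length_le)
  · exact fun a h => h.2 rfl
  · rintro a b c ⟨hac, -⟩ ⟨hbc, -⟩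
    by_cases h : path a = path b
    · exact Or.inl (inj _ _ h)
    · rcases List.suffix_or_suffix_of_suffix hac hbc with h' | h'
      · exact Or.inr (Or.inl ⟨h', h⟩)
      · exact Or.inr (Or.inr ⟨h', Ne.symm h⟩)
  · intro F hF
    -- Truth lemma: `F` contains the atoms of `Φ`, so the values left free by `Sat` do not affect
    -- formulas of `Φ`.
    have truth : ∀ C ∈ Φ, ∀ w (f : Atom → Prop),
        (∀ p ∈ F, f p ↔ .atom p ∈ (pathSet X (path w)).1) →
        (Sat (fun w u => path w <:+ path u ∧ path w ≠ path u)
          (fun w p => .atom p ∈ (pathSet X (path w)).1) F w f C ↔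
            C ∈ (pathSet X (path w)).1) := by
      intro C
      induction C with
      | atom p => exact fun hp w f hf => hf p (hF (by simpa using hp))
      | bot => exact fun _ w _ _ => iff_of_false id (pathSet X (path w)).2.1.bot
      | imp C D ihC ihD =>
        intro h w f hf
        rw [(pathSet X (path w)).2.1.imp, ← ihC (himp _ _ h).1 w f hf, ← ihD (himp _ _ h).2 w f hf]
        rfl
      | box C ih =>
        intro h w f _
        constructor
        · intro hs
          by_contra hC
          obtain ⟨u, hu⟩ := surj (C :: path w) ⟨hpath w, h, hC⟩
          refine (successor_spec _ hC).2.2 ?_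
          have := (ih (hbox _ h) u _ fun _ _ => Iff.rfl).1
            (hs u ⟨hu ▸ List.suffix_cons _ _, fun h => by simp [hu] at h⟩ _ fun _ _ => Iff.rfl)
          rwa [hu] at this
        · rintro hC u ⟨h1, h2⟩ g hg
          exact (ih (hbox _ h) u g hg).2 (pathSet_of_suffix (hpath u) h1 h2 hC).1
    obtain ⟨w, hw⟩ := surj [] trivial
    refine ⟨w, fun h => hAX ?_⟩
    have := (truth A hAΦ w _ fun _ _ => Iff.rfl).1 h
    rwa [hw] at this

/-! ### The provability model of a transitive frame -/

variable {F : Finset Atom}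

/-- The formulas that are true at `w` and all worlds above it, for all values of the atoms
outside `F`. -/
def upTheorems (r : W → W → Prop) (V : W → Atom → Prop) (F : Finset Atom) (w : W) :
    Set (Formula Atom) :=
  {A | ∀ v, v = w ∨ r w v → ∀ f : Atom → Prop, (∀ p ∈ F, f p ↔ V v p) → Sat r V F v f A}

theorem upTheorems_mp {w : W} {A B : Formula Atom} (hA : A ∈ upTheorems r V F w)
    (hAB : A.imp B ∈ upTheorems r V F w) : B ∈ upTheorems r V F w :=
  fun v hv f hf => hAB v hv f hf (hA v hv f hf)

theorem upTheorems_nec (htrans : ∀ a b c, r a b → r b c → r a c) {w : W} {A : Formula Atom}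
    (hA : A ∈ upTheorems r V F w) : box A ∈ upTheorems r V F w := by
  rintro v (rfl | hv) f _ u hu g hg
  · exact hA u (Or.inr hu) g hg
  · exact hA u (Or.inr (htrans _ _ _ hv hu)) g hg

theorem upTheorems_of_tautology {w : W} {A : Formula Atom} (hA : A.Tautology) :
    A ∈ upTheorems r V F w :=
  fun v _ f _ => (isBoolean_sat v f).mem_of_tautology hA

variable [Nonempty W]

/-- A frame with a valuation as a Kripke model. -/
def kripkeModel (r : W → W → Prop) (V : W → Atom → Prop) : KripkeModel.{u, v} Atom :=
  ⟨W, inferInstance, r, V⟩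

/-- The theorems at `w` are the formulas that are true at `w` and all worlds above it. -/
def upModel (r : W → W → Prop) (V : W → Atom → Prop) (F : Finset Atom) :
    PreModel (kripkeModel r V) :=
  ⟨fun w => ⟨upTheorems r V F w.1, modusPonens Atom ∪ necessitation Atom⟩⟩

theorem provable_upModel (htrans : ∀ a b c, r a b → r b c → r a c)
    (w : (kripkeModel r V).Accessible) (A : Formula Atom) :
    ((upModel r V F).thy w).Provable A ↔ A ∈ upTheorems r V F w.1 := by
  refine ⟨fun h => ?_, fun h => .ax h⟩
  unfold Theory.Provable at h
  induction h with
  | ax h => exact h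
  | hyp h => exact h.elim
  | rule ρ hρ _ ih =>
    rcases hρ with ⟨B, C, hp, hc⟩ | ⟨B, hp, hc⟩ <;> rw [hp] at ih <;> rw [hc]
    · exact upTheorems_mp (ih B (by simp)) (ih _ (by simp))
    · exact upTheorems_nec htrans (ih B rfl)

/-- In the box case, a world above a successor is itself a successor, so requiring truth there as
well adds nothing. -/
theorem forces_upModel (htrans : ∀ a b c, r a b → r b c → r a c) (w : W) (A : Formula Atom) :
    (upModel r V F).Forces w A ↔ Sat r V F w (V w) A := by
  induction A with
  | atom p => rfl
  | bot => rfl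
  | imp A B ihA ihB => exact imp_congr ihA ihB
  | box A =>
    constructor
    · intro h u hu
      exact (provable_upModel htrans _ A).1 (h u hu) u (Or.inl rfl)
    · intro h u hu
      refine (provable_upModel htrans _ A).2 ?_
      rintro v (rfl | hv)
      · exact h v hu
      · exact h v (htrans _ _ _ hu hv)

theorem hasNecessitation_upModel : (upModel r V F).HasNecessitation :=
  fun _ => Set.subset_union_right

/-- The worlds where `w ⊨⁺ A` guarantees truth include `w` and everything above it, and a purely
modal formula ignores the values of atoms at the world of evaluation. -/
theorem modallyComplete_upModel (htrans : ∀ a b c, r a b → r b c → r a c) :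
    (upModel r V F).ModallyComplete := by
  rintro w A hA ⟨u, hu, h⟩
  refine (provable_upModel htrans w A).2 fun v hv f _ => ?_
  refine (sat_of_purelyModal hA v _ f).1 ((forces_upModel htrans v A).1 (h v ?_))
  rcases hv with rfl | hv
  · exact .single hu
  · exact .tail (.single hu) hv

theorem isProvabilityModel_upModel (htrans : ∀ a b c, r a b → r b c → r a c) :
    (upModel r V F).IsProvabilityModel :=
  ⟨fun _ => ⟨Set.subset_union_left, fun _ hA => .ax (upTheorems_of_tautology hA.tautology)⟩,
    modallyComplete_upModel htrans⟩

theorem converseWellFounded_kripkeModel (hr : WellFounded (fun u w => r w u)) :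
    (kripkeModel r V).ConverseWellFounded := by
  intro X hX
  obtain ⟨w, hw, h⟩ := hr.has_min X hX
  exact ⟨w, hw, h⟩

theorem isTree_kripkeModel (htree : ∀ a b c, r a c → r b c → a = b ∨ r a b ∨ r b a) :
    (kripkeModel r V).IsTree := fun a b c hac hbc =>
  (htree a b c hac hbc).imp id (Or.imp .single .single)

/-! ### Characteristic formulas -/

/-- The conjunction of literals with atoms from `F` that are true under `f`. -/
noncomputable def literals (F : Finset Atom) (f : Atom → Prop) : Formula Atom :=
  open Classical in
  conj (F.toList.map fun p => if f p then .atom p else neg (.atom p))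

/-- All formulas in `L` are possible, and necessarily one of them is true. -/
def modalPart (L : List (Formula Atom)) : Formula Atom :=
  conj (box (disj L) :: L.map fun A => neg (box (neg A)))

theorem purelyModal_modalPart (L : List (Formula Atom)) : (modalPart L).PurelyModal := by
  refine purelyModal_conj fun A hA => ?_
  rcases List.mem_cons.1 hA with rfl | hA
  · trivial
  · obtain ⟨B, -, rfl⟩ := List.mem_map.1 hA
    exact ⟨trivial, trivial⟩

theorem IsBoolean.literals_mem_iff {X : Set (Formula Atom)} (hX : IsBoolean X)
    (F : Finset Atom) (f : Atom → Prop) :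
    literals F f ∈ X ↔ ∀ p ∈ F, Formula.atom p ∈ X ↔ f p := by
  simp only [literals, hX.conj_mem_iff, List.forall_mem_map, Finset.mem_toList]
  refine forall₂_congr fun p _ => ?_
  by_cases h : f p <;> simp [h, hX.neg_mem_iff]

theorem IsBoolean.modalPart_mem_iff {X : Set (Formula Atom)} (hX : IsBoolean X)
    (L : List (Formula Atom)) :
    modalPart L ∈ X ↔ box (disj L) ∈ X ∧ ∀ A ∈ L, box A.neg ∉ X := by
  simp [modalPart, hX.conj_mem_iff, hX.neg_mem_iff]

end Semantics

section Characteristic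

variable {Atom : Type u} {W : Type v} [Finite W] {r : W → W → Prop} {V : W → Atom → Prop}

/-- The worlds accessible from `w`. -/
noncomputable def above (r : W → W → Prop) (w : W) : List W :=
  (Set.toFinite {u | r w u}).toFinset.toList

theorem mem_above {w u : W} : u ∈ above r w ↔ r w u := by simp [above]

/-- `χ w` describes the world `w` up to bisimulation with respect to the atoms in `F`. -/
def IsCharacteristic (r : W → W → Prop) (V : W → Atom → Prop) (F : Finset Atom)
    (χ : W → Formula Atom) : Prop :=
  ∀ w, χ w = conj [literals F (V w), modalPart ((above r w).map χ)]

theorem wellFounded_of_finite (htrans : ∀ a b c, r a b → r b c → r a c) (hirr : ∀ a, ¬ r a a) :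
    WellFounded (fun u w => r w u) := by
  have : IsTrans W (fun u w => r w u) := ⟨fun _ _ _ hab hbc => htrans _ _ _ hbc hab⟩
  have : Std.Irrefl (fun u w => r w u) := ⟨hirr⟩
  exact Finite.wellFounded_of_trans_of_irrefl _

theorem exists_isCharacteristic (hr : WellFounded (fun u w => r w u)) (V : W → Atom → Prop)
    (F : Finset Atom) : ∃ χ, IsCharacteristic r V F χ := by
  -- Attaching membership proofs to the list justifies the recursive calls.
  refine ⟨hr.fix fun w ih => conj [literals F (V w),
    modalPart ((above r w).attach.map fun u => ih u.1 (mem_above.1 u.2))], fun w => ?_⟩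
  rw [hr.fix_eq]
  exact congrArg (fun L => conj [literals F (V w), modalPart L]) List.attach_map_val

variable {F : Finset Atom} {χ : W → Formula Atom}

theorem IsBoolean.characteristic_mem_iff {X : Set (Formula Atom)} (hX : IsBoolean X)
    (hχ : IsCharacteristic r V F χ) (w : W) :
    χ w ∈ X ↔ (∀ p ∈ F, Formula.atom p ∈ X ↔ V w p) ∧ modalPart ((above r w).map χ) ∈ X := by
  rw [hχ w, hX.conj_mem_iff, ← hX.literals_mem_iff]
  simp

theorem sat_characteristic_iff (hχ : IsCharacteristic r V F χ) (w x : W) (f : Atom → Prop) :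
    Sat r V F x f (χ w) ↔
      (∀ p ∈ F, f p ↔ V w p) ∧ Sat r V F x f (modalPart ((above r w).map χ)) :=
  (isBoolean_sat x f).characteristic_mem_iff hχ w

theorem sat_modalPart_iff (χ : W → Formula Atom) (w x : W) (f : Atom → Prop) :
    Sat r V F x f (modalPart ((above r w).map χ)) ↔
      (∀ y, r x y → ∀ g : Atom → Prop, (∀ p ∈ F, g p ↔ V y p) →
        ∃ u, r w u ∧ Sat r V F y g (χ u)) ∧
      ∀ u, r w u → ∃ y, r x y ∧ ∃ g : Atom → Prop, (∀ p ∈ F, g p ↔ V y p) ∧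
        Sat r V F y g (χ u) := by
  refine ((isBoolean_sat x f).modalPart_mem_iff _).trans (and_congr ?_ ?_)
  · refine forall₄_congr fun y _ g _ => ((isBoolean_sat y g).disj_mem_iff _).trans ?_
    simp [mem_above]
  · simp [mem_above, Sat, neg]

theorem sat_characteristic_self (hr : WellFounded (fun u w => r w u))
    (hχ : IsCharacteristic r V F χ) (w : W) :
    ∀ f : Atom → Prop, (∀ p ∈ F, f p ↔ V w p) → Sat r V F w f (χ w) := by
  induction w using hr.induction with
  | _ w ih =>
    intro f hf
    refine (sat_characteristic_iff hχ w w f).2 ⟨hf, (sat_modalPart_iff χ w w f).2 ⟨?_, ?_⟩⟩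
    · exact fun u hu g hg => ⟨u, hu, ih u hu g hg⟩
    · exact fun u hu => ⟨u, hu, V u, fun _ _ => Iff.rfl, ih u hu _ fun _ _ => Iff.rfl⟩

/-- The modal part of `χ w` expresses the back-and-forth conditions of a bisimulation. Assuming only
the modal part leaves the atoms at `x` arbitrary. -/
theorem sat_box_iff_of_sat_modalPart (hχ : IsCharacteristic r V F χ) {C : Formula Atom}
    (hC : ∀ u y (h : Atom → Prop), Sat r V F y h (χ u) → (Sat r V F y h C ↔ Sat r V F u h C))
    {w x : W} {f : Atom → Prop} (hx : Sat r V F x f (modalPart ((above r w).map χ)))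
    (g : Atom → Prop) :
    Sat r V F x f (box C) ↔ Sat r V F w g (box C) := by
  obtain ⟨forth, back⟩ := (sat_modalPart_iff χ w x f).1 hx
  constructor
  · intro h u hu k hk
    obtain ⟨y, hy, l, hl, hly⟩ := back u hu
    obtain ⟨hlu, hmod⟩ := (sat_characteristic_iff hχ u y l).1 hly
    -- The witness `l` from `back` may differ from `k` outside `F`. Both agree with `V u` on `F`,
    -- and the modal part does not depend on the assignment, so `y` satisfies `χ u` under `k` as
    -- well.
    refine (hC u y k ((sat_characteristic_iff hχ u y k).2 ⟨hk, ?_⟩)).1 (h y hy k ?_)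
    · exact (sat_of_purelyModal (purelyModal_modalPart _) _ _ _).1 hmod
    · exact fun p hp => (hk p hp).trans ((hlu p hp).symm.trans (hl p hp))
  · intro h y hy k hk
    obtain ⟨u, hu, huy⟩ := forth y hy k hk
    exact (hC u y k huy).2 (h u hu k ((sat_characteristic_iff hχ u y k).1 huy).1)

/-- A point that satisfies `χ w` satisfies the same formulas as `w`. -/
theorem sat_iff_of_sat_characteristic (hχ : IsCharacteristic r V F χ) (C : Formula Atom) :
    ∀ w x (f : Atom → Prop), Sat r V F x f (χ w) → (Sat r V F x f C ↔ Sat r V F w f C) := by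
  induction C with
  | atom p => exact fun _ _ _ _ => Iff.rfl
  | bot => exact fun _ _ _ _ => Iff.rfl
  | imp C D ihC ihD => exact fun w x f h => imp_congr (ihC w x f h) (ihD w x f h)
  | box C ih => exact fun w x f h =>
      sat_box_iff_of_sat_modalPart hχ ih ((sat_characteristic_iff hχ w x f).1 h).2 f

/-- Over all atoms, characteristic formulas decide every formula in the minimal normal modal
logic. -/
theorem characteristic_decides {S : Set (Formula Atom)} (hS : DeductivelyClosed S)
    (hnec : ∀ A ∈ S, box A ∈ S)
    (hdistrib : ∀ A B : Formula Atom, (box (A.imp B)).imp ((box A).imp (box B)) ∈ S)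
    (hF : ∀ p, p ∈ F) (hχ : IsCharacteristic r V F χ) (C : Formula Atom) :
    ∀ w, (Sat r V F w (V w) C → (χ w).imp C ∈ S) ∧
      (¬ Sat r V F w (V w) C → (χ w).imp C.neg ∈ S) := by
  have mono : ∀ A B : Formula Atom, A.imp B ∈ S → (box A).imp (box B) ∈ S :=
    fun A B h => hS.mp _ _ (hnec _ h) (hdistrib A B)
  induction C with
  | atom p =>
    intro w
    constructor <;> intro h <;> refine hS.mem_of_forall_isBoolean fun X hX _ => ?_
    · exact (hX.imp _ _).2 fun hw => (((hX.characteristic_mem_iff hχ w).1 hw).1 p (hF p)).2 h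
    · refine (hX.imp _ _).2 fun hw => (hX.neg_mem_iff _).2 fun hp => h ?_
      exact (((hX.characteristic_mem_iff hχ w).1 hw).1 p (hF p)).1 hp
  | bot => exact fun w => ⟨fun h => h.elim, fun _ => hS.imp_of_mem _ (hS.imp_self _)⟩
  | imp C D ihC ihD =>
    intro w
    constructor <;> intro h <;> refine hS.mem_of_forall_isBoolean fun X hX hSX => ?_
    · refine (hX.imp _ _).2 fun hw => (hX.imp _ _).2 fun hC => ?_
      by_cases h' : Sat r V F w (V w) C
      · exact (hX.imp _ _).1 (hSX ((ihD w).1 (h h'))) hw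
      · exact absurd hC ((hX.neg_mem_iff _).1 ((hX.imp _ _).1 (hSX ((ihC w).2 h')) hw))
    · obtain ⟨h1, h2⟩ := Classical.not_imp.1 h
      refine (hX.imp _ _).2 fun hw => (hX.neg_mem_iff _).2 fun hCD => ?_
      exact (hX.neg_mem_iff _).1 ((hX.imp _ _).1 (hSX ((ihD w).2 h2)) hw)
        ((hX.imp _ _).1 hCD ((hX.imp _ _).1 (hSX ((ihC w).1 h1)) hw))
  | box C ih =>
    intro w
    constructor <;> intro h
    · have h1 : (disj ((above r w).map χ)).imp C ∈ S := by
        refine hS.mem_of_forall_isBoolean fun X hX hSX => (hX.imp _ _).2 fun hd => ?_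
        obtain ⟨A, hA, hAX⟩ := (hX.disj_mem_iff _).1 hd
        obtain ⟨u, hu, rfl⟩ := List.mem_map.1 hA
        exact (hX.imp _ _).1 (hSX ((ih u).1 (h u (mem_above.1 hu) _ fun _ _ => Iff.rfl))) hAX
      refine hS.mem_of_forall_isBoolean fun X hX hSX => (hX.imp _ _).2 fun hw => ?_
      exact (hX.imp _ _).1 (hSX (mono _ _ h1))
        ((hX.modalPart_mem_iff _).1 ((hX.characteristic_mem_iff hχ w).1 hw).2).1
    · obtain ⟨u, hu, hCu⟩ : ∃ u, r w u ∧ ¬ Sat r V F u (V u) C := by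
        by_contra hcon
        push Not at hcon
        refine h fun u hu g hg => ?_
        -- With all atoms in `F`, the assignment at `u` is forced.
        rw [show g = V u from funext fun p => propext (hg p (hF p))]
        exact hcon u hu
      have h1 : C.imp (χ u).neg ∈ S := by
        refine hS.mem_of_forall_isBoolean fun X hX hSX => (hX.imp _ _).2 fun hC => ?_
        refine (hX.neg_mem_iff _).2 fun hu => ?_
        exact (hX.neg_mem_iff _).1 ((hX.imp _ _).1 (hSX ((ih u).2 hCu)) hu) hC
      refine hS.mem_of_forall_isBoolean fun X hX hSX => (hX.imp _ _).2 fun hw => ?_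
      refine (hX.neg_mem_iff _).2 fun hC => ?_
      exact ((hX.modalPart_mem_iff _).1 ((hX.characteristic_mem_iff hχ w).1 hw).2).2 _
        (List.mem_map_of_mem (mem_above.2 hu)) ((hX.imp _ _).1 (hSX (mono _ _ h1)) hC)

/-! ### Generating the model from one axiom per world -/

/-- One of the worlds `v` such that `v = w` or `v` is above `w` is described correctly by `χ v`. -/
noncomputable def upDisj (r : W → W → Prop) (χ : W → Formula Atom) (w : W) : Formula Atom :=
  disj ((w :: above r w).map χ)

theorem IsBoolean.upDisj_mem_iff {X : Set (Formula Atom)} (hX : IsBoolean X)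
    (χ : W → Formula Atom) (w : W) : upDisj r χ w ∈ X ↔ ∃ v, (v = w ∨ r w v) ∧ χ v ∈ X := by
  simp [upDisj, hX.disj_mem_iff, mem_above]

theorem characteristic_mem_upTheorems (hr : WellFounded (fun u w => r w u))
    (hχ : IsCharacteristic r V F χ) (w : W) :
    upDisj r χ w ∈ upTheorems r V F w := by
  intro v hv f hf
  exact ((isBoolean_sat v f).upDisj_mem_iff χ w).2 ⟨v, hv, sat_characteristic_self hr hχ v f hf⟩

variable [Nonempty W]

/-- The pre-model with axiom `upDisj r χ w` at `w`. -/
noncomputable def characteristicPreModel (r : W → W → Prop) (V : W → Atom → Prop)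
    (χ : W → Formula Atom) : PreModel (kripkeModel r V) :=
  ⟨fun w => ⟨{upDisj r χ w.1}, ∅⟩⟩

theorem biFinite_characteristicPreModel : (characteristicPreModel r V χ).BiFinite :=
  ⟨‹Finite W›, fun _ => ⟨Set.finite_singleton _, rfl⟩⟩

theorem submodel_upModel (hr : WellFounded (fun u w => r w u))
    (hχ : IsCharacteristic r V F χ) :
    (characteristicPreModel r V χ).Submodel (upModel r V F) := by
  intro w A h
  cases h with
  | ax h =>
    rw [show A = _ from h]
    exact .ax (characteristic_mem_upTheorems hr hχ w.1)
  | hyp h => exact h.elim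
  | rule ρ hρ _ => exact hρ.elim

/-- For minimality, a competing theory at `w` proves the axiom at `w`, and each `χ v` in that
disjunction implies every formula true at `v`. -/
theorem finitary_upModel (htrans : ∀ a b c, r a b → r b c → r a c) (hirr : ∀ a, ¬ r a a)
    (htree : ∀ a b c, r a c → r b c → a = b ∨ r a b ∨ r b a) [Fintype Atom] :
    (upModel r V Finset.univ).Finitary := by
  have hr := wellFounded_of_finite htrans hirr
  obtain ⟨χ, hχ⟩ := exists_isCharacteristic hr V Finset.univ
  refine ⟨characteristicPreModel r V χ, biFinite_characteristicPreModel,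
    converseWellFounded_kripkeModel hr, isTree_kripkeModel htree,
    ⟨isProvabilityModel_upModel htrans, hasNecessitation_upModel, submodel_upModel hr hχ⟩, ?_⟩
  intro P hP hPnec hsub w A hA
  have hS := (hP.1 w).deductivelyClosed
  -- Distribution is purely modal and true at every world, as the theories are closed under modus
  -- ponens; modal completeness therefore makes it a theorem.
  have hdistrib : ∀ B C : Formula Atom,
      (box (B.imp C)).imp ((box B).imp (box C)) ∈ {A | (P.thy w).Provable A} := by
    intro B C
    obtain ⟨u, hu⟩ := w.2
    refine hP.2 w _ ⟨trivial, trivial, trivial⟩ ⟨u, hu, fun v _ hBC hB x hx => ?_⟩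
    exact (hB x hx).mp (hP.1 _).1 (hBC x hx)
  have hdec := characteristic_decides hS (fun B hB => Theory.Provable.nec (hPnec w) hB) hdistrib
    Finset.mem_univ hχ A
  have hax : upDisj r χ w.1 ∈ {A | (P.thy w).Provable A} :=
    hsub w _ (.ax rfl)
  refine hS.mem_of_forall_isBoolean fun X hX hSX => ?_
  obtain ⟨v, hv, hvX⟩ := (hX.upDisj_mem_iff χ w.1).1 (hSX hax)
  refine (hX.imp _ _).1 (hSX ((hdec v).1 ?_)) hvX
  exact (provable_upModel htrans w A).1 hA v hv _ fun _ _ => Iff.rfl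

/-- A boolean set containing all theorems of the stage theory contains some `χ v`. It is then
exactly the set of formulas true at `v` under its own assignment of atoms, which agrees with `V v`
on `F`; hence it contains every formula of `upTheorems` at `w`. -/
theorem recursivelyFinitary_upModel (htrans : ∀ a b c, r a b → r b c → r a c)
    (hirr : ∀ a, ¬ r a a) (htree : ∀ a b c, r a c → r b c → a = b ∨ r a b ∨ r b a) :
    (upModel r V F).RecursivelyFinitary := by
  have hr := wellFounded_of_finite htrans hirr
  obtain ⟨χ, hχ⟩ := exists_isCharacteristic hr V F
  refine ⟨characteristicPreModel r V χ, biFinite_characteristicPreModel,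
    converseWellFounded_kripkeModel hr, isTree_kripkeModel htree,
    isProvabilityModel_upModel htrans, hasNecessitation_upModel, fun w A => ?_⟩
  set T := PreModel.stageTheory (characteristicPreModel r V χ) (upModel r V F) w with hT
  have hstage : ∀ B ∈ PreModel.stageSet (characteristicPreModel r V χ) (upModel r V F) w,
      T.Provable B := fun B hB => .ax (Or.inl hB)
  rw [provable_upModel htrans]
  constructor
  · intro hA
    have hS : DeductivelyClosed {B | T.Provable B} :=
      ⟨fun B hB => hstage B (Or.inr hB.tautology), fun B C hB hBC => hB.mp subset_rfl hBC⟩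
    have hmodal : ∀ B : Formula Atom, B.PurelyModal → (∀ x, Sat r V F x (V x) B) →
        T.Provable B := by
      intro B hB h
      obtain ⟨u, hu⟩ := w.2
      exact hstage B (Or.inl (Or.inr ⟨hB, u, hu, fun x _ => (forces_upModel htrans x B).2 (h x)⟩))
    refine hS.mem_of_forall_isBoolean fun X hX hSX => ?_
    obtain ⟨v, hv, hvX⟩ := (hX.upDisj_mem_iff χ w.1).1 (hSX (hstage _ (Or.inl (Or.inl rfl))))
    obtain ⟨hlit, hmod⟩ := (hX.characteristic_mem_iff hχ v).1 hvX
    have truth : ∀ C, C ∈ X ↔ Sat r V F v (fun p => .atom p ∈ X) C := by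
      intro C
      induction C with
      | atom p => rfl
      | bot => exact iff_of_false hX.bot id
      | imp C D ihC ihD => exact (hX.imp C D).trans (imp_congr ihC ihD)
      | box C =>
        -- No induction hypothesis is needed: the implication from the modal part of `χ v` to `□C`,
        -- or to `¬□C`, is purely modal and valid at all worlds, so it belongs to the stage set.
        have hbox := fun x => sat_box_iff_of_sat_modalPart hχ (sat_iff_of_sat_characteristic hχ C)
          (w := v) (x := x) (f := V x)
        by_cases h : Sat r V F v (fun p => .atom p ∈ X) (box C)
        · refine iff_of_true ((hX.imp _ _).1 (hSX (hmodal
            ((modalPart ((above r v).map χ)).imp (box C)) ⟨purelyModal_modalPart _, trivial⟩ ?_))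
            hmod) h
          exact fun x hx => (hbox x hx _).2 h
        · refine iff_of_false ((hX.neg_mem_iff _).1 ((hX.imp _ _).1 (hSX (hmodal
            ((modalPart ((above r v).map χ)).imp (box C).neg)
            ⟨purelyModal_modalPart _, trivial, trivial⟩ ?_)) hmod)) h
          exact fun x hx hC => h ((hbox x hx _).1 hC)
    exact (truth A).2 (hA v hv _ hlit)
  · have sound : PreModel.stageSet (characteristicPreModel r V χ) (upModel r V F) w ⊆
        upTheorems r V F w.1 := by
      rintro B ((hB | ⟨hB, hB'⟩) | hB)
      · rw [show B = _ from hB]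
        exact characteristic_mem_upTheorems hr hχ w.1
      · exact (provable_upModel htrans w B).1 (modallyComplete_upModel htrans w B hB hB')
      · exact upTheorems_of_tautology hB
    refine Theory.Provable.mem_of_axioms rfl ?_ fun _ _ => upTheorems_mp
    rintro B (hB | ⟨C, hC, rfl⟩)
    · exact sound hB
    · exact upTheorems_nec htrans (sound hC)

end Characteristic

end ProvabilityModels

theorem mainTheorem5 (Atom : Type u) :
    (Finite Atom →
      (ProvabilityModels.logicGL Atom).CompleteFor
        (fun (K : ProvabilityModels.KripkeModel.{u, v} Atom) =>
          {P : ProvabilityModels.PreModel K | P.Finitary})) ∧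
    (ProvabilityModels.logicGL Atom).CompleteFor
      (fun (K : ProvabilityModels.KripkeModel.{u, v} Atom) =>
        {P : ProvabilityModels.PreModel K | P.RecursivelyFinitary}) := by
  constructor
  · intro _ A hA
    by_contra h
    obtain ⟨W, r, V, _, _, htrans, hirr, htree, F, hF⟩ :=
      ProvabilityModels.exists_countermodel.{u, v} h
    have := Fintype.ofFinite Atom
    obtain ⟨w, hw⟩ := hF Finset.univ (Finset.subset_univ F)
    exact hw ((ProvabilityModels.forces_upModel htrans w A).1
      (hA _ _ (ProvabilityModels.finitary_upModel htrans hirr htree) w))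
  · intro A hA
    by_contra h
    obtain ⟨W, r, V, _, _, htrans, hirr, htree, F, hF⟩ :=
      ProvabilityModels.exists_countermodel.{u, v} h
    obtain ⟨w, hw⟩ := hF F subset_rfl
    exact hw ((ProvabilityModels.forces_upModel htrans w A).1
      (hA _ _ (ProvabilityModels.recursivelyFinitary_upModel htrans hirr htree) w))
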